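/- For $p\in[0,1]$ let $\mu_p$ be the Bernoulli $p$-measure on Cantor space $2^\omega$, i.e. $\mu_p([\sigma])=p^{\#_0(\sigma)}(1-p)^{\#_1(\sigma)}$ for every finite binary string $\sigma$, where $[\sigma]$ is the set of infinite sequences extending $\sigma$ and $\#_i(\sigma)$ is the number of occurrences of $i$ in $\sigma$. A Borel probability measure $\xi$ on $2^\omega$ is computable if the reals $\xi([\sigma])$ are computable uniformly in $\sigma$. A $\mu$-Martin-Löf test relative to $z\in 2^\omega$ is a sequence $(U_i)_{i\in\omega}$ of uniformly $\Sigma^{0,z}_1$ subsets of $2^\omega$ with $\mu(U_i)\le 2^{-i}$ for all $i$. A sequence $x\in2^\omega$ is $\xi$-random (for a computable measure $\xi$) if $x\notin\bigcap_i U_i$ for every $\xi$-Martin-Löf test $(U_i)_i$ without oracle, and it is $\mu_p$-random if $x\notin\bigcap_i U_i$ for every $\mu_p$-Martin-Löf test $(U_i)_i$ relative to (the binary expansion of) $p$. **Theorem** (no computable mixture of Bernoulli measures includes all computable Bernoulli measures). There is no computable probability measure $\xi$ on $2^\omega$ such that for every computable real $c\in[0,1]$ there is a sequence $x\in 2^\omega$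 that is both $\xi$-random and $\mu_c$-random. In particular, no computable mixture of Bernoulli measures has this property. -/

import Mathlib

namespace CantorRandomness

open MeasureTheory

/-- Cantor space: infinite binary sequences, with `false` for the symbol 0 and `true` for 1. -/
abbrev Cantor : Type := ℕ → Bool

/-- The basic clopen set of all infinite sequences that extend the finite string `σ`. -/
def cylinder (σ : List Bool) : Set Cantor :=
  {x | ∀ (i : ℕ) (h : i < σ.length), x i = σ[i]}

/-- A family of real numbers is uniformly computable: a computable function produces, from an
index `a` and a precision `n`, a dyadic rational (the numerator being given as a difference of
two natural numbers) that is within `2 ^ (-n)` of `r a`. -/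
def UniformlyComputableReal {α : Type} [Primcodable α] (r : α → ℝ) : Prop :=
  ∃ f g : α → ℕ → ℕ, Computable₂ f ∧ Computable₂ g ∧
    ∀ (a : α) (n : ℕ), |r a - ((f a n : ℝ) - (g a n : ℝ)) / 2 ^ n| ≤ 1 / 2 ^ n

/-- A computable real number. -/
def ComputableReal (r : ℝ) : Prop :=
  UniformlyComputableReal (fun _ : Unit => r)

/-- A measure on Cantor space is computable if the measures of the basic clopen sets are
computable real numbers, uniformly in the string. -/
def ComputableMeasure (μ : Measure Cantor) : Prop :=
  UniformlyComputableReal (fun σ : List Bool => μ.real (cylinder σ))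

/-- An infinite binary sequence as an oracle. -/
def oracle (z : Cantor) : ℕ →. ℕ :=
  fun n => Part.some (z n).toNat

/-- The predicate `P` is recursively enumerable relative to the oracle `z`. -/
def REPredIn {α : Type} [Primcodable α] (z : Cantor) (P : α → Prop) : Prop :=
  RecursiveIn {oracle z} (fun a => Part.assert (P a) fun _ => Part.some ())

/-- A uniformly `Σ⁰₁` sequence of subsets of Cantor space, relative to `z`: the sets `U i` are
unions of basic clopen sets, enumerated uniformly in `i` with oracle `z`. -/
def UniformlySigma01 (z : Cantor) (U : ℕ → Set Cantor) : Prop :=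
  ∃ W : ℕ × List Bool → Prop, REPredIn z W ∧
    ∀ i, U i = {x | ∃ σ, W (i, σ) ∧ x ∈ cylinder σ}

/-- A `μ`-Martin-Löf test relative to `z`. -/
def IsMLTest (μ : Measure Cantor) (z : Cantor) (U : ℕ → Set Cantor) : Prop :=
  UniformlySigma01 z U ∧ ∀ i, μ (U i) ≤ (2⁻¹ : ENNReal) ^ i

/-- `x` is `μ`-Martin-Löf random relative to `z`. -/
def MLRandomRel (μ : Measure Cantor) (z x : Cantor) : Prop :=
  ∀ U : ℕ → Set Cantor, IsMLTest μ z U → x ∉ ⋂ i, U i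

/-- `x` is `μ`-Martin-Löf random (no oracle, that is, the oracle `000…`). -/
def MLRandom (μ : Measure Cantor) (x : Cantor) : Prop :=
  MLRandomRel μ (fun _ => false) x

/-- The Bernoulli `p`-measure on Cantor space: the bits are independent, and each of them is 0
with probability `p` and 1 with probability `1 - p`. -/
noncomputable def bernoulliCantor (p : unitInterval) : Measure Cantor :=
  Measure.infinitePi fun _ : ℕ => ProbabilityTheory.bernoulliMeasure false true p

/-- The Bernoulli `p`-measure takes the value `p ^ #₀(σ) * (1 - p) ^ #₁(σ)` on the basic clopen
set given by the string `σ`. -/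
theorem bernoulliCantor_cylinder (p : unitInterval) (σ : List Bool) :
    (bernoulliCantor p).real (cylinder σ) =
      (p : ℝ) ^ σ.count false * (1 - (p : ℝ)) ^ σ.count true := by
  have hset : cylinder σ =
      Set.pi (Finset.range σ.length : Set ℕ) (fun i => {σ.getD i false}) := by
    ext x
    simp only [cylinder, Set.mem_ofPred_eq, Set.mem_pi, Finset.coe_range, Set.mem_Iio,
      Set.mem_singleton_iff]
    refine forall_congr' fun i => forall_congr' fun h => ?_
    rw [List.getD_eq_getElem _ _ h]
  have hone : ∀ b : Bool, (ProbabilityTheory.bernoulliMeasure false true p).real {b} =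
      if b then 1 - (p : ℝ) else (p : ℝ) := by
    intro b
    rw [ProbabilityTheory.bernoulliMeasure_real_apply p (measurableSet_singleton b)]
    cases b <;> simp
  have hprod : ∀ τ : List Bool,
      ∏ i ∈ Finset.range τ.length,
        (ProbabilityTheory.bernoulliMeasure false true p).real {τ.getD i false} =
      (p : ℝ) ^ τ.count false * (1 - (p : ℝ)) ^ τ.count true := by
    intro τ
    induction τ with
    | nil => simp
    | cons b τ ih =>
      rw [List.length_cons, Finset.prod_range_succ']
      simp only [List.getD_cons_succ, List.getD_cons_zero]
      rw [ih, hone]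
      cases b <;> simp <;> ring
  rw [← hprod, hset, bernoulliCantor, measureReal_def, Measure.infinitePi_pi _
    (fun i _ => measurableSet_singleton _), ENNReal.toReal_prod]
  rfl

/-- The sequence of binary digits of a real `p ∈ [0,1]` after the binary point, the one that is
not eventually 1 if `p` is a dyadic rational (and `000…` for `p = 1`). -/
noncomputable def binaryDigits (p : unitInterval) : Cantor :=
  fun n => decide (⌊(p : ℝ) * 2 ^ (n + 1)⌋₊ % 2 = 1)

/-- `x` is Bernoulli `p`-random: it passes every `μ_p`-Martin-Löf test relative to `p`. -/
def BernoulliRandom (p : unitInterval) (x : Cantor) : Prop :=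
  MLRandomRel (bernoulliCantor p) (binaryDigits p) x

end CantorRandomness

namespace CantorRandomness

open MeasureTheory

/-! ### Computability of sums, unbounded search and bit counts -/

section Computability

variable {α β : Type} [Primcodable α] [Primcodable β]

/-! Diagonalise against `ξ` using the frequency of zeros. Build nested dyadic intervals `[m k / 2 ^
d k, (m k + 1) / 2 ^ d k]` shrinking to a computable `c`. With `n` bits and `n = 2 ^ d * q`, the
event `zeroCountSet n q m` says that the observed frequency of zeros lies in the `m`-th dyadic
interval of level `d` (right end excluded).

The events for different `m` are disjoint, so among `N` candidate subintervals one has `ξ`-measure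
at most `1 / N`. Since `ξ` is computable, an interval nearly as light can be found by search
(`exists_computable_light_sequence`). Candidates are confined to the middle half of the current
interval, so `c` stays away from all endpoints, and Chebyshev gives the chosen event `μ_c`-measure
close to 1 (`bernoulliCantor_compl_zeroCountSet_le`).

Both error bounds are summable, so by `MLRandomRel.eventually_avoids` a `ξ`-random sequence lies in
only finitely many chosen events and a `μ_c`-random one in all but finitely many. No sequence does
both. -/

theorem computable_list_sum {L : α → List β} {g : α → β → ℕ} (hL : Computable L)
    (hg : Computable₂ g) : Computable fun a => ((L a).map (g a)).sum := by
  have h : Computable fun a => Nat.rec (motive := fun _ => ℕ) 0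
      (fun i s => s + Option.casesOn (motive := fun _ => ℕ) (L a)[i]? 0 (g a)) (L a).length := by
    refine Computable.nat_rec (Computable.list_length.comp hL) (Computable.const 0)
      (h := fun a p => p.2 + Option.casesOn (motive := fun _ => ℕ) (L a)[p.1]? 0 (g a)) ?_
    refine Primrec.nat_add.to_comp.comp (Computable.snd.comp Computable.snd) ?_
    refine Computable.option_casesOn (o := fun q : α × ℕ × ℕ => (L q.1)[q.2.1]?)
      (g := fun q b => g q.1 b) ?_ (Computable.const 0) ?_
    · exact Computable.list_getElem?.comp (hL.comp Computable.fst)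
        (Computable.fst.comp Computable.snd)
    · exact hg.comp (Computable.fst.comp Computable.fst) Computable.snd
  refine h.of_eq fun a => ?_
  -- The recursion sums the first `n` entries; an index out of range contributes 0.
  have key : ∀ n, Nat.rec (motive := fun _ => ℕ) 0
      (fun i s => s + Option.casesOn (motive := fun _ => ℕ) (L a)[i]? 0 (g a)) n =
      (((L a).take n).map (g a)).sum := by
    intro n
    induction n with
    | zero => simp
    | succ n ih =>
      simp only [ih, List.take_add_one, List.map_append, List.sum_append]
      cases (L a)[n]? <;> simp
  rw [key, List.take_length]

theorem exists_computable_choice {p : α → ℕ → Bool} (hp : Computable₂ p)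
    (h : ∀ a, ∃ n, p a n = true) : ∃ f : α → ℕ, Computable f ∧ ∀ a, p a (f a) = true := by
  have hd : ∀ a, (Nat.rfind fun n => Part.some (p a n)).Dom := fun a => by
    obtain ⟨n, hn⟩ := h a
    obtain ⟨m, hm, -⟩ := Nat.rfind_min' hn
    exact Part.dom_iff_mem.2 ⟨m, hm⟩
  refine ⟨fun a => (Nat.rfind fun n => Part.some (p a n)).get (hd a), ?_, fun a => ?_⟩
  · have := Partrec.rfind (p := fun a n => Part.some (p a n)) hp
    exact this.of_eq_tot fun a => Part.get_mem _
  · have := Nat.rfind_spec (Part.get_mem (hd a))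
    exact (Part.mem_some_iff.1 this).symm

theorem rePredIn_exists (z : Cantor) {p : α → ℕ → Bool} (hp : Computable₂ p) :
    REPredIn z fun a => ∃ n, p a n = true := by
  have h := (Partrec.rfind (p := fun a n => Part.some (p a n)) hp).dom_re
  have h' : REPred fun a => ∃ n, p a n = true := h.of_eq fun a => by
    refine Nat.rfind_dom'.trans ?_
    constructor
    · rintro ⟨n, hn, -⟩
      exact ⟨n, (Part.mem_some_iff.1 hn).symm⟩
    · rintro ⟨n, hn⟩
      exact ⟨n, Part.mem_some_iff.2 hn.symm, fun _ => trivial⟩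
  exact Partrec.recursiveIn h'

theorem primrec_two_pow : Primrec fun n : ℕ => 2 ^ n := by
  refine (Primrec.nat_rec₁ 1 (f := fun _ m => 2 * m)
    (Primrec.nat_mul.comp (Primrec.const 2) Primrec.snd)).of_eq fun n => ?_
  induction n with
  | zero => rfl
  | succ n ih => simp only [ih, pow_succ']

theorem primrec_count_false : Primrec fun σ : List Bool => σ.count false := by
  refine (Primrec.list_foldr (f := id) (g := fun _ => 0)
    (h := fun _ p => cond p.1 p.2 (p.2 + 1)) Primrec.id (Primrec.const 0) ?_).of_eq fun σ => ?_
  · exact Primrec.cond (Primrec.fst.comp Primrec.snd) (Primrec.snd.comp Primrec.snd)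
      (Primrec.succ.comp (Primrec.snd.comp Primrec.snd))
  · induction σ with
    | nil => rfl
    | cons b σ ih => cases b <;> simp_all

end Computability

/-! ### Finite strings, cylinders and clopen sets -/

/-- The list of all binary strings of length `n`. -/
def strings : ℕ → List (List Bool)
  | 0 => [[]]
  | n + 1 => (strings n).map (List.cons false) ++ (strings n).map (List.cons true)

theorem primrec_strings : Primrec strings := by
  refine (Primrec.nat_rec₁ [[]] (f := fun _ L =>
    L.map (List.cons false) ++ L.map (List.cons true)) ?_).of_eq fun n => ?_
  · exact Primrec.list_append.comp
      (Primrec.list_map Primrec.snd (Primrec.list_cons.comp (Primrec.const _) Primrec.snd))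
      (Primrec.list_map Primrec.snd (Primrec.list_cons.comp (Primrec.const _) Primrec.snd))
  · induction n with
    | zero => rfl
    | succ n ih => simp only [ih, strings]

theorem mem_strings {n : ℕ} {σ : List Bool} : σ ∈ strings n ↔ σ.length = n := by
  induction n generalizing σ with
  | zero => simp [strings]
  | succ n ih =>
    cases σ with
    | nil => simp [strings]
    | cons b σ => cases b <;> simp [strings, ih]

theorem length_strings (n : ℕ) : (strings n).length = 2 ^ n := by
  induction n with
  | zero => rfl
  | succ n ih => simp [strings, ih, pow_succ, mul_two]

theorem nodup_strings (n : ℕ) : (strings n).Nodup := by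
  induction n with
  | zero => simp [strings]
  | succ n ih =>
    rw [strings, List.nodup_append]
    refine ⟨ih.map (List.cons_injective), ih.map (List.cons_injective), ?_⟩
    simp

/-- The string of the first `n` bits of `x`. -/
def initialSegment (n : ℕ) (x : Cantor) : List Bool :=
  List.ofFn fun i : Fin n => x i

@[simp]
theorem length_initialSegment (n : ℕ) (x : Cantor) : (initialSegment n x).length = n := by
  simp [initialSegment]

theorem mem_cylinder_iff {σ : List Bool} {x : Cantor} :
    x ∈ cylinder σ ↔ initialSegment σ.length x = σ := by
  constructor
  · intro h
    refine List.ext_getElem (by simp) fun i h₁ h₂ => ?_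
    simpa [initialSegment] using h i h₂
  · intro h i hi
    have : (initialSegment σ.length x)[i]'(by simpa using hi) = σ[i] := by simp only [h]
    simpa [initialSegment] using this

theorem measurableSet_cylinder (σ : List Bool) : MeasurableSet (cylinder σ) := by
  have : cylinder σ = ⋂ (i : ℕ) (h : i < σ.length), (fun x : Cantor => x i) ⁻¹' {σ[i]} := by
    ext x
    simp [cylinder]
  rw [this]
  exact MeasurableSet.iInter fun i => MeasurableSet.iInter fun h =>
    measurable_pi_apply i (measurableSet_singleton _)

theorem setOf_initialSegment_eq (n : ℕ) (p : List Bool → Prop) [DecidablePred p] :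
    {x : Cantor | p (initialSegment n x)} =
      ⋃ σ ∈ (strings n).toFinset.filter p, cylinder σ := by
  ext x
  simp only [Set.mem_ofPred_eq, Finset.mem_filter, List.mem_toFinset, mem_strings, Set.mem_iUnion,
    mem_cylinder_iff, exists_prop]
  constructor
  · intro h
    exact ⟨_, ⟨length_initialSegment n x, h⟩, by simp⟩
  · rintro ⟨σ, ⟨rfl, h⟩, hx⟩
    rwa [hx]

theorem measureReal_initialSegment (ξ : Measure Cantor) [IsFiniteMeasure ξ] (n : ℕ)
    (p : List Bool → Prop) [DecidablePred p] :
    ξ.real {x | p (initialSegment n x)} =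
      ∑ σ ∈ (strings n).toFinset.filter p, ξ.real (cylinder σ) := by
  rw [setOf_initialSegment_eq, measureReal_biUnion_finset _ fun σ _ => measurableSet_cylinder σ]
  intro σ hσ τ hτ hne
  refine Set.disjoint_left.2 fun x hx hx' => hne ?_
  simp only [Finset.coe_filter, List.mem_toFinset, mem_strings, Set.mem_ofPred_eq] at hσ hτ
  rw [mem_cylinder_iff] at hx hx'
  rw [← hx, ← hx', hσ.1, hτ.1]

theorem measurableSet_initialSegment (n : ℕ) (p : List Bool → Prop) :
    MeasurableSet {x : Cantor | p (initialSegment n x)} := by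
  classical
  rw [setOf_initialSegment_eq]
  exact Finset.measurableSet_biUnion _ fun σ _ => measurableSet_cylinder σ

/-- An effective first Borel–Cantelli lemma: a random sequence avoids almost all members of a
computable sequence of clopen sets of measures at most `2 ^ (-k - 1)`. -/
theorem MLRandomRel.eventually_avoids {μ : Measure Cantor} {z x : Cantor}
    (hx : MLRandomRel μ z x) {n : ℕ → ℕ} (hn : Computable n) {p : ℕ → List Bool → Bool}
    (hp : Computable₂ p)
    (hμ : ∀ k, μ {y | p k (initialSegment (n k) y) = true} ≤ (2⁻¹ : ENNReal) ^ (k + 1)) :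
    ∃ i, ∀ k, i ≤ k → p k (initialSegment (n k) x) = false := by
  by_contra! hcon
  -- The tail unions form a test: they are enumerable without consulting the oracle, and the bounds
  -- from index `i` on sum to `2 ^ (-i)`.
  refine hx (fun i => ⋃ k, {y | p (i + k) (initialSegment (n (i + k)) y) = true}) ⟨?_, ?_⟩ ?_
  · refine ⟨_, rePredIn_exists (α := ℕ × List Bool) z (p := fun a k =>
      decide (a.2.length = n (a.1 + k)) && p (a.1 + k) a.2) ?_, fun i => ?_⟩
    · have h1 : Computable fun q : (ℕ × List Bool) × ℕ => q.1.1 + q.2 :=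
        Primrec.nat_add.to_comp.comp (Computable.fst.comp Computable.fst) Computable.snd
      refine Primrec.and.to_comp.comp ?_ (hp.comp h1 (Computable.snd.comp Computable.fst))
      exact (Primrec.eq (α := ℕ)).decide.to_comp.comp
        (Computable.list_length.comp (Computable.snd.comp Computable.fst)) (hn.comp h1)
    · ext y
      simp only [Set.mem_iUnion, Set.mem_ofPred_eq, Bool.and_eq_true, decide_eq_true_eq,
        mem_cylinder_iff]
      constructor
      · rintro ⟨k, hk⟩
        exact ⟨_, ⟨k, length_initialSegment _ y, hk⟩, by simp⟩
      · rintro ⟨σ, ⟨k, hl, hk⟩, hy⟩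
        refine ⟨k, ?_⟩
        rwa [← hl, hy]
  · intro i
    refine (measure_iUnion_le _).trans ?_
    calc ∑' k, μ {y | p (i + k) (initialSegment (n (i + k)) y) = true}
        ≤ ∑' k : ℕ, (2⁻¹ : ENNReal) ^ i * (2⁻¹) ^ (k + 1) := by
          refine ENNReal.tsum_le_tsum fun k => (hμ _).trans_eq ?_
          rw [← pow_add, add_assoc]
      _ = 2⁻¹ ^ i := by
          rw [ENNReal.tsum_mul_left, ENNReal.tsum_geometric_add_one, ENNReal.one_sub_inv_two,
            inv_inv, ENNReal.inv_mul_cancel (by simp) (by simp), mul_one]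
  · refine Set.mem_iInter.2 fun i => ?_
    obtain ⟨k, hk, hp'⟩ := hcon i
    refine Set.mem_iUnion.2 ⟨k - i, ?_⟩
    simpa [Nat.add_sub_cancel' hk] using hp'

/-! ### Zero-count events and the choice of light ones -/

/-- The sequences for which the number of zeros among the first `n` bits lies in the `m`-th
interval of length `q`. -/
def zeroCountSet (n q m : ℕ) : Set Cantor :=
  {x | (initialSegment n x).count false / q = m}

/-- The sum of the values `h σ` over the strings `σ` of length `n` for which the number of zeros
lies in the `m`-th interval of length `q`. -/
def zeroCountSum (h : List Bool → ℕ) (n q m : ℕ) : ℕ :=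
  ((strings n).map fun σ => (if σ.count false / q = m then 1 else 0) * h σ).sum

theorem measurableSet_zeroCountSet (n q m : ℕ) : MeasurableSet (zeroCountSet n q m) :=
  measurableSet_initialSegment n fun σ => σ.count false / q = m

theorem computable_zeroCountSum {α : Type} [Primcodable α] {h : α → List Bool → ℕ}
    {n q m : α → ℕ} (hh : Computable₂ h) (hn : Computable n) (hq : Computable q)
    (hm : Computable m) : Computable fun a => zeroCountSum (h a) (n a) (q a) (m a) := by
  refine computable_list_sum (primrec_strings.to_comp.comp hn) ?_
  refine Primrec.nat_mul.to_comp.comp ?_ hh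
  have h1 : Computable fun p : α × List Bool => decide (p.2.count false / q p.1 = m p.1) :=
    (Primrec.eq (α := ℕ)).decide.to_comp.comp
      (Primrec.nat_div.to_comp.comp (primrec_count_false.to_comp.comp Computable.snd)
        (hq.comp Computable.fst)) (hm.comp Computable.fst)
  exact (Computable.cond h1 (Computable.const 1) (Computable.const 0)).of_eq fun p => by
    by_cases h : p.2.count false / q p.1 = m p.1 <;> simp [h]

/-- The event is a disjoint union of at most `2 ^ n` cylinders, each contributing an error of at
most `1 / 2 ^ r`. -/
theorem abs_measureReal_zeroCountSet_sub_le (ξ : Measure Cantor) [IsFiniteMeasure ξ]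
    {f g : List Bool → ℕ} {r : ℕ}
    (h : ∀ σ, |ξ.real (cylinder σ) - ((f σ : ℝ) - (g σ : ℝ)) / 2 ^ r| ≤ 1 / 2 ^ r) (n q m : ℕ) :
    |ξ.real (zeroCountSet n q m) -
      ((zeroCountSum f n q m : ℝ) - (zeroCountSum g n q m : ℝ)) / 2 ^ r| ≤ 2 ^ n / 2 ^ r := by
  have hsum : ∀ h : List Bool → ℕ, (zeroCountSum h n q m : ℝ) =
      ∑ σ ∈ (strings n).toFinset.filter (fun σ => σ.count false / q = m), (h σ : ℝ) := by
    intro h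
    rw [zeroCountSum, ← List.sum_toFinset _ (nodup_strings n), Finset.sum_filter]
    push_cast
    exact Finset.sum_congr rfl fun σ _ => by split_ifs <;> simp
  rw [hsum, hsum, zeroCountSet, measureReal_initialSegment ξ n fun σ => σ.count false / q = m,
    ← Finset.sum_sub_distrib, Finset.sum_div, ← Finset.sum_sub_distrib]
  refine (Finset.abs_sum_le_sum_abs _ _).trans ((Finset.sum_le_card_nsmul _ _ _
    fun σ _ => h σ).trans ?_)
  have hcard : ((strings n).toFinset.filter (fun σ => σ.count false / q = m)).card ≤ 2 ^ n :=
    (Finset.card_filter_le _ _).trans ((List.toFinset_card_le _).trans_eq (length_strings n))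
  rw [nsmul_eq_mul, mul_one_div]
  gcongr
  exact_mod_cast hcard

/-- Pigeonhole: the `N` events are pairwise disjoint, so their measures sum to at most 1. -/
theorem exists_measureReal_zeroCountSet_le (ξ : Measure Cantor) [IsProbabilityMeasure ξ]
    (n q b : ℕ) {N : ℕ} (hN : 0 < N) :
    ∃ j < N, ξ.real (zeroCountSet n q (b + j)) ≤ 1 / N := by
  have hle : ∑ j ∈ Finset.range N, ξ.real (zeroCountSet n q (b + j)) ≤
      ∑ _j ∈ Finset.range N, (1 / N : ℝ) := by
    rw [← measureReal_biUnion_finset _ fun j _ => measurableSet_zeroCountSet n q (b + j)]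
    · refine measureReal_le_one.trans_eq ?_
      have : (N : ℝ) ≠ 0 := by positivity
      simp [this]
    · intro i _ j _ hij
      refine Set.disjoint_left.2 fun x hx hx' => hij ?_
      simp only [zeroCountSet, Set.mem_ofPred_eq] at hx hx'
      omega
  obtain ⟨j, hj, h⟩ := Finset.exists_le_of_sum_le (Finset.nonempty_range_iff.2 hN.ne') hle
  exact ⟨j, Finset.mem_range.1 hj, h⟩

theorem exists_computable_light_sequence (ξ : Measure Cantor) [IsProbabilityMeasure ξ]
    (hξ : ComputableMeasure ξ) {n q : ℕ → ℕ} (hn : Computable n) (hq : Computable q) :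
    ∃ m : ℕ → ℕ, Computable m ∧ m 0 = 0 ∧
      (∀ k, ∃ j < 2 ^ (2 * k + 2), m (k + 1) = m k * 2 ^ (2 * k + 3) + 2 ^ (2 * k + 1) + j) ∧
      ∀ k, ξ.real (zeroCountSet (n (k + 1)) (q (k + 1)) (m (k + 1))) ≤ 1 / 2 ^ (k + 1) := by
  obtain ⟨f, g, hf, hg, hfg⟩ := hξ
  -- At stage `k + 1` this precision makes the total error over all strings at most `2 ^ (-(2 * k +
  -- 3))`.
  let r : ℕ → ℕ := fun k => n k + (2 * k + 1)
  -- Of the `2 ^ (2 * k + 3)` subintervals, skip the first quarter; `j < 2 ^ (2 * k + 2)` then runs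
  -- over the middle half.
  let next : ℕ × ℕ → ℕ → ℕ := fun a j =>
    a.2 * 2 ^ (2 * a.1 + 3) + 2 ^ (2 * a.1 + 1) + j
  let S : (List Bool → ℕ → ℕ) → ℕ × ℕ → ℕ → ℕ := fun h a j =>
    zeroCountSum (fun σ => h σ (r (a.1 + 1))) (n (a.1 + 1)) (q (a.1 + 1)) (next a j)
  have happrox : ∀ a j, |ξ.real (zeroCountSet (n (a.1 + 1)) (q (a.1 + 1)) (next a j)) -
      ((S f a j : ℝ) - (S g a j : ℝ)) / 2 ^ r (a.1 + 1)| ≤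
      2 ^ n (a.1 + 1) / 2 ^ r (a.1 + 1) := fun a j =>
    abs_measureReal_zeroCountSet_sub_le ξ (fun σ => hfg σ _) _ _ _
  have hfst : Computable fun p : (ℕ × ℕ) × ℕ => p.1.1 := Computable.fst.comp Computable.fst
  have hlin : ∀ c d : ℕ, Primrec fun k : ℕ => 2 ^ (c * k + d) := fun c d =>
    primrec_two_pow.comp (Primrec.nat_add.comp
      (Primrec.nat_mul.comp (Primrec.const c) Primrec.id) (Primrec.const d))
  have hnext : Computable₂ next := by
    refine Primrec.nat_add.to_comp.comp (Primrec.nat_add.to_comp.comp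
      (Primrec.nat_mul.to_comp.comp (Computable.snd.comp Computable.fst)
        ((hlin 2 3).to_comp.comp hfst)) ((hlin 2 1).to_comp.comp hfst)) Computable.snd
  have hr : Computable r := by
    refine Primrec.nat_add.to_comp.comp hn ?_
    exact (Primrec.nat_add.comp (Primrec.nat_mul.comp (Primrec.const 2) Primrec.id)
      (Primrec.const 1)).to_comp
  have hS : ∀ h, Computable₂ h → Computable₂ (S h) := fun h hh =>
    computable_zeroCountSum (α := (ℕ × ℕ) × ℕ) (h := fun p σ => h σ (r (p.1.1 + 1)))
      (hh.comp Computable.snd (hr.comp (Computable.succ.comp (hfst.comp Computable.fst))))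
      (hn.comp (Computable.succ.comp hfst)) (hq.comp (Computable.succ.comp hfst)) hnext
  -- With error unit `ε = 2 ^ (-(2 * k + 3))`, pigeonhole gives a true measure at most `2 * ε`,
  -- hence an approximation at most `3 * ε`. Conversely, passing this decidable test forces a true
  -- measure at most `4 * ε ≤ 2 ^ (-(k + 1))`.
  obtain ⟨c, hc, hcp⟩ := exists_computable_choice (α := ℕ × ℕ)
    (p := fun a j => decide (j < 2 ^ (2 * a.1 + 2)) &&
      decide (S f a j ≤ S g a j + 3 * 2 ^ n (a.1 + 1))) (by
    refine Primrec.and.to_comp.comp ?_ ?_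
    · exact Primrec.nat_lt.decide.to_comp.comp Computable.snd ((hlin 2 2).to_comp.comp hfst)
    · exact Primrec.nat_le.decide.to_comp.comp (hS f hf) (Primrec.nat_add.to_comp.comp (hS g hg)
        (Primrec.nat_mul.to_comp.comp (Computable.const 3)
          (primrec_two_pow.to_comp.comp (hn.comp (Computable.succ.comp hfst)))))) (by
    intro a
    obtain ⟨j, hj, hle⟩ := exists_measureReal_zeroCountSet_le ξ (n (a.1 + 1)) (q (a.1 + 1))
      (a.2 * 2 ^ (2 * a.1 + 3) + 2 ^ (2 * a.1 + 1)) (N := 2 ^ (2 * a.1 + 2)) (by positivity)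
    refine ⟨j, ?_⟩
    simp only [Bool.and_eq_true, decide_eq_true_eq]
    refine ⟨hj, ?_⟩
    have h1 := (abs_le.1 (happrox a j)).1
    have hpow : (2 : ℝ) ^ r (a.1 + 1) = 2 ^ n (a.1 + 1) * (2 * 2 ^ (2 * a.1 + 2)) := by
      simp only [r]; ring
    have h2 : ((S f a j : ℝ) - (S g a j : ℝ)) / 2 ^ r (a.1 + 1) ≤
        3 * 2 ^ n (a.1 + 1) / 2 ^ r (a.1 + 1) := by
      have : (3 : ℝ) * 2 ^ n (a.1 + 1) / 2 ^ r (a.1 + 1) =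
          1 / 2 ^ (2 * a.1 + 2) + 2 ^ n (a.1 + 1) / 2 ^ r (a.1 + 1) := by
        rw [hpow]; field_simp; norm_num
      push_cast at hle
      simp only [next] at h1 ⊢
      linarith
    have h3 := (div_le_div_iff_of_pos_right (by positivity)).1 h2
    have h4 : (S f a j : ℝ) ≤ S g a j + 3 * 2 ^ n (a.1 + 1) := by linarith
    exact_mod_cast h4)
  simp only [Bool.and_eq_true, decide_eq_true_eq] at hcp
  let m : ℕ → ℕ := fun k => Nat.rec 0 (fun k s => next (k, s) (c (k, s))) k
  have hsucc : ∀ k, m (k + 1) = next (k, m k) (c (k, m k)) := fun k => rfl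
  refine ⟨m, ?_, rfl, fun k => ⟨_, (hcp (k, m k)).1, hsucc k⟩, fun k => ?_⟩
  · exact Computable.nat_rec (h := fun (_ : ℕ) (p : ℕ × ℕ) => next p (c p)) Computable.id
      (Computable.const 0) (hnext.comp Computable.snd (hc.comp Computable.snd))
  · rw [hsucc]
    have h1 := (abs_le.1 (happrox (k, m k) (c (k, m k)))).2
    have h2 : (S f (k, m k) (c (k, m k)) : ℝ) ≤
      S g (k, m k) (c (k, m k)) + 3 * 2 ^ n (k + 1) := by exact_mod_cast (hcp (k, m k)).2
    have h3 : ((S f (k, m k) (c (k, m k)) : ℝ) - (S g (k, m k) (c (k, m k)) : ℝ)) /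
        2 ^ r (k + 1) ≤ 3 * 2 ^ n (k + 1) / 2 ^ r (k + 1) := by
      gcongr; linarith
    have hpow : (2 : ℝ) ^ r (k + 1) = 2 ^ n (k + 1) * (8 * (2 ^ k * 2 ^ k)) := by
      simp only [r]; ring
    have h4 : (3 : ℝ) * 2 ^ n (k + 1) / 2 ^ r (k + 1) + 2 ^ n (k + 1) / 2 ^ r (k + 1) =
        1 / 2 ^ (k + 1) * (1 / 2 ^ k) := by
      rw [hpow]; field_simp; ring
    have h5 : (1 : ℝ) / 2 ^ (k + 1) * (1 / 2 ^ k) ≤ 1 / 2 ^ (k + 1) := by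
      refine mul_le_of_le_one_right (by positivity) ?_
      rw [div_le_one (by positivity)]
      exact one_le_pow₀ one_le_two
    simp only at h1
    linarith

/-! ### Concentration of the zero count under Bernoulli measures -/

theorem initialSegment_succ (n : ℕ) (x : Cantor) :
    initialSegment (n + 1) x = initialSegment n x ++ [x n] := by
  rw [initialSegment, List.ofFn_succ_last]
  rfl

theorem count_false_initialSegment (n : ℕ) (x : Cantor) :
    ((initialSegment n x).count false : ℝ) =
      ∑ i ∈ Finset.range n, if x i = false then (1 : ℝ) else 0 := by
  induction n with
  | zero => simp [initialSegment]
  | succ n ih =>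
    rw [initialSegment_succ, List.count_append, Finset.sum_range_succ, ← ih]
    cases x n <;> simp

instance (p : unitInterval) : IsProbabilityMeasure (bernoulliCantor p) := by
  unfold bernoulliCantor
  infer_instance

/-- Chebyshev for independent indicators; a variable with values in `[0, 1]` has variance at most `1
/ 4`, so the bound is uniform in `p`. -/
theorem bernoulliCantor_zero_count_deviation_le (p : unitInterval) (n : ℕ) {t : ℝ} (ht : 0 < t) :
    bernoulliCantor p {x | t ≤ |((initialSegment n x).count false : ℝ) - n * p|} ≤
      ENNReal.ofReal (n / 4 / t ^ 2) := by
  let b : Bool → ℝ := fun y => if y = false then 1 else 0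
  let X : ℕ → Cantor → ℝ := fun i x => b (x i)
  have hb : Measurable b := by fun_prop
  have hX : ∀ i, Measurable (X i) := fun i => hb.comp (measurable_pi_apply i)
  have hbdd : ∀ i x, X i x ∈ Set.Icc (0 : ℝ) 1 := by
    intro i x
    simp only [X, b]
    split_ifs <;> simp
  have hLp : ∀ i, MemLp (X i) 2 (bernoulliCantor p) := fun i =>
    MemLp.of_bound (hX i).aestronglyMeasurable 1 (Filter.Eventually.of_forall fun x => by
      rw [Real.norm_eq_abs, abs_of_nonneg (hbdd i x).1]
      exact (hbdd i x).2)
  have hind : ProbabilityTheory.iIndepFun X (bernoulliCantor p) :=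
    ProbabilityTheory.iIndepFun_infinitePi (X := fun _ : ℕ => b) fun _ => hb
  have hmean : ∀ i, ∫ x, X i x ∂bernoulliCantor p = p := by
    intro i
    have h := measurePreserving_eval_infinitePi
      (fun _ : ℕ => ProbabilityTheory.bernoulliMeasure false true p) i
    have h' := integral_map (μ := bernoulliCantor p) (f := b) (measurable_pi_apply i).aemeasurable
      hb.aestronglyMeasurable
    have hmap : (bernoulliCantor p).map (fun x => x i) =
      ProbabilityTheory.bernoulliMeasure false true p := h.map_eq
    rw [hmap, ProbabilityTheory.integral_bernoulliMeasure] at h'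
    rw [← h']
    simp [b]
  have hvar : ProbabilityTheory.variance (∑ i ∈ Finset.range n, X i) (bernoulliCantor p) ≤
      n / 4 := by
    rw [ProbabilityTheory.IndepFun.variance_sum (fun i _ => hLp i)
      fun i _ j _ hij => hind.indepFun hij]
    refine (Finset.sum_le_card_nsmul _ _ (1 / 4) fun i _ => ?_).trans_eq ?_
    · refine (ProbabilityTheory.variance_le_sq_of_bounded
        (Filter.Eventually.of_forall (hbdd i)) (hX i).aemeasurable).trans_eq ?_
      norm_num
    · rw [Finset.card_range, nsmul_eq_mul]
      ring
  have hsum : ∫ x, (∑ i ∈ Finset.range n, X i) x ∂bernoulliCantor p = n * p := by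
    simp only [Finset.sum_apply]
    rw [integral_finsetSum _ fun i _ => (hLp i).integrable one_le_two]
    simp [hmean]
  have h := ProbabilityTheory.meas_ge_le_variance_div_sq
    (memLp_finsetSum' (Finset.range n) fun i _ => hLp i) ht
  rw [hsum] at h
  refine le_trans (le_of_eq ?_) (h.trans (ENNReal.ofReal_le_ofReal (by gcongr)))
  congr 1
  ext x
  simp only [Set.mem_ofPred_eq, count_false_initialSegment, Finset.sum_apply, X, b]

/-- The mean zero count is at least `q / 4` away from both ends of the `m`-th block, so leaving the
block is a deviation of at least `q / 4`. The exponents are chosen so that `n / 4 / (q / 4) ^ 2 = 2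
^ (-k)`. -/
theorem bernoulliCantor_compl_zeroCountSet_le (p : unitInterval) {d k m : ℕ}
    (h₁ : m + 1 / 4 ≤ (p : ℝ) * 2 ^ d) (h₂ : (p : ℝ) * 2 ^ d ≤ m + 3 / 4) :
    bernoulliCantor p (zeroCountSet (2 ^ (2 * d + k + 2)) (2 ^ (d + k + 2)) m)ᶜ ≤
      (2⁻¹ : ENNReal) ^ k := by
  set q : ℕ := 2 ^ (d + k + 2) with hq
  have hq0 : 0 < q := by positivity
  have hq0' : (0 : ℝ) < q := by exact_mod_cast hq0
  have hn : 2 ^ (2 * d + k + 2) = 2 ^ d * q := by rw [hq]; ring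
  have hsub : (zeroCountSet (2 ^ (2 * d + k + 2)) q m)ᶜ ⊆
      {x | (q / 4 : ℝ) ≤ |((initialSegment (2 ^ (2 * d + k + 2)) x).count false : ℝ) -
        (2 ^ (2 * d + k + 2) : ℕ) * p|} := by
    intro x hx
    simp only [zeroCountSet, Set.mem_compl_iff, Set.mem_ofPred_eq] at hx ⊢
    set Z := (initialSegment (2 ^ (2 * d + k + 2)) x).count false
    have hn' : ((2 ^ (2 * d + k + 2) : ℕ) : ℝ) * p = (p * 2 ^ d) * q := by
      rw [hn]; push_cast; ring
    rw [hn']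
    have h₁' := mul_le_mul_of_nonneg_right h₁ hq0'.le
    have h₂' := mul_le_mul_of_nonneg_right h₂ hq0'.le
    rcases lt_or_gt_of_ne hx with h | h
    · have hZ : (Z : ℝ) < m * q := by exact_mod_cast (Nat.div_lt_iff_lt_mul hq0).1 h
      rw [le_abs]
      right
      linarith
    · have hZ : ((m + 1 : ℕ) : ℝ) * q ≤ Z := by
        exact_mod_cast (Nat.le_div_iff_mul_le hq0).1 (Nat.succ_le_of_lt h)
      push_cast at hZ
      rw [le_abs]
      left
      linarith
  refine (measure_mono hsub).trans
    ((bernoulliCantor_zero_count_deviation_le p _ (by positivity)).trans_eq ?_)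
  have : ((2 ^ (2 * d + k + 2) : ℕ) : ℝ) / 4 / (q / 4 : ℝ) ^ 2 = 2⁻¹ ^ k := by
    have hq' : (q : ℝ) = 2 ^ d * 2 ^ k * 4 := by
      rw [hq]; push_cast; ring
    rw [hn, Nat.cast_mul, hq', inv_pow]
    push_cast
    field_simp
  rw [this, ENNReal.ofReal_pow (by norm_num), ENNReal.ofReal_inv_of_pos two_pos,
    ENNReal.ofReal_ofNat]

/-! ### The computable limit parameter and the contradiction -/

theorem exists_computableReal_of_nested {m : ℕ → ℕ} (hm : Computable m) (h0 : m 0 = 0)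
    (hsucc : ∀ k, ∃ j < 2 ^ (2 * k + 2),
      m (k + 1) = m k * 2 ^ (2 * k + 3) + 2 ^ (2 * k + 1) + j) :
    ∃ c : unitInterval, ComputableReal (c : ℝ) ∧ ∀ k,
      (m k : ℝ) + 1 / 4 ≤ c * 2 ^ (k * (k + 2)) ∧ (c : ℝ) * 2 ^ (k * (k + 2)) ≤ m k + 3 / 4 := by
  let d : ℕ → ℕ := fun k => k * (k + 2)
  have hd : ∀ k, d (k + 1) = d k + (2 * k + 3) := fun k => by simp only [d]; ring
  have hstep : ∀ k, ((m k : ℝ) + 1 / 4) * 2 ^ (2 * k + 3) ≤ m (k + 1) ∧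
      (m (k + 1) : ℝ) + 1 ≤ (m k + 3 / 4) * 2 ^ (2 * k + 3) := by
    intro k
    obtain ⟨j, hj, h⟩ := hsucc k
    have hj' : (j : ℝ) + 1 ≤ 2 ^ (2 * k + 2) := by exact_mod_cast hj
    have h' : (m (k + 1) : ℝ) = m k * 2 ^ (2 * k + 3) + 2 ^ (2 * k + 1) + j := by exact_mod_cast h
    have e1 : (2 : ℝ) ^ (2 * k + 3) = 4 * 2 ^ (2 * k + 1) := by ring
    have e2 : (2 : ℝ) ^ (2 * k + 2) = 2 * 2 ^ (2 * k + 1) := by ring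
    rw [e1] at h' ⊢
    rw [e2] at hj'
    have := j.cast_nonneg (α := ℝ)
    constructor <;> linarith
  let lo : ℕ → ℝ := fun k => m k / 2 ^ d k
  let hi : ℕ → ℝ := fun k => (m k + 1) / 2 ^ d k
  have hlo : Monotone lo := monotone_nat_of_le_succ fun k => by
    simp only [lo, hd, pow_add]
    rw [div_le_div_iff₀ (by positivity) (by positivity)]
    have := (hstep k).1
    have hp : (0 : ℝ) < 2 ^ d k := by positivity
    have hp' : (0 : ℝ) < 2 ^ (2 * k + 3) := by positivity
    simp only [pow_add] at this hp' ⊢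
    nlinarith
  have hhi : Antitone hi := antitone_nat_of_succ_le fun k => by
    simp only [hi, hd, pow_add]
    rw [div_le_div_iff₀ (by positivity) (by positivity)]
    have := (hstep k).2
    have hp : (0 : ℝ) < 2 ^ d k := by positivity
    have hp' : (0 : ℝ) < 2 ^ (2 * k + 3) := by positivity
    simp only [pow_add] at this hp' ⊢
    nlinarith
  have hle : ∀ k, lo k ≤ hi k := fun k => by
    simp only [lo, hi]
    gcongr
    linarith
  have hmem := hlo.ciSup_mem_iInter_Icc_of_antitone hhi hle
  set c : ℝ := ⨆ k, lo k
  have hc : ∀ k, (m k : ℝ) ≤ c * 2 ^ d k ∧ c * 2 ^ d k ≤ m k + 1 := fun k => by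
    have := Set.mem_iInter.1 hmem k
    exact ⟨(div_le_iff₀ (by positivity)).1 this.1, (le_div_iff₀ (by positivity)).1 this.2⟩
  have hcI : c ∈ Set.Icc (0 : ℝ) 1 := by
    have := hc 0
    simpa [d, h0] using this
  refine ⟨⟨c, hcI⟩, ?_, fun k => ?_⟩
  -- As `d n = n + n * (n + 1)`, the quotient truncates the left endpoint to `n` binary digits; the
  -- resulting interval of length `2 ^ (-n)` still contains `c`.
  · refine ⟨fun _ n => m n / 2 ^ (n * (n + 1)), fun _ _ => 0, ?_, ?_, fun _ n => ?_⟩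
    · have : Primrec fun n : ℕ => 2 ^ (n * (n + 1)) :=
        primrec_two_pow.comp (Primrec.nat_mul.comp Primrec.id Primrec.succ)
      exact (Primrec.nat_div.to_comp.comp hm this.to_comp).comp Computable.snd
    · exact Computable.const 0
    · set a := m n / 2 ^ (n * (n + 1))
      have hp : (0 : ℝ) < 2 ^ (n * (n + 1)) := by positivity
      have h1 : (a : ℝ) * 2 ^ (n * (n + 1)) ≤ m n := by
        exact_mod_cast Nat.div_mul_le_self (m n) (2 ^ (n * (n + 1)))
      have h2 : (m n : ℝ) + 1 ≤ (a + 1) * 2 ^ (n * (n + 1)) := by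
        exact_mod_cast Nat.lt_mul_of_div_lt (Nat.lt_succ_self a) (by positivity)
      have hdn : (2 : ℝ) ^ d n = 2 ^ n * 2 ^ (n * (n + 1)) := by
        rw [← pow_add]; congr 1; simp only [d]; ring
      obtain ⟨h3, h4⟩ := hc n
      rw [hdn, ← mul_assoc] at h3 h4
      have h5 : (a : ℝ) ≤ c * 2 ^ n := le_of_mul_le_mul_right (h1.trans h3) hp
      have h6 : c * 2 ^ n ≤ a + 1 := le_of_mul_le_mul_right (h4.trans h2) hp
      have hn : (0 : ℝ) < 2 ^ n := by positivity
      have h7 : c - ((a : ℝ) - ((0 : ℕ) : ℝ)) / 2 ^ n = (c * 2 ^ n - a) / 2 ^ n := by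
        field_simp; simp
      rw [h7, abs_of_nonneg (div_nonneg (by linarith) hn.le)]
      gcongr
      linarith
  -- The margin at stage `k` is seen one stage later: interval `k + 1` contains `c` and lies in the
  -- middle half of interval `k`.
  · have hp : (0 : ℝ) < 2 ^ (2 * k + 3) := by positivity
    obtain ⟨h1, h2⟩ := hc (k + 1)
    rw [hd, pow_add, ← mul_assoc] at h1 h2
    exact ⟨le_of_mul_le_mul_right ((hstep k).1.trans h1) hp,
      le_of_mul_le_mul_right (h2.trans (hstep k).2) hp⟩

theorem exists_computable_disjoint_bernoulliRandom (ξ : Measure Cantor) [IsProbabilityMeasure ξ]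
    (hξ : ComputableMeasure ξ) :
    ∃ c : unitInterval, ComputableReal (c : ℝ) ∧
      ∀ x, MLRandom ξ x → ¬ BernoulliRandom c x := by
  let d : ℕ → ℕ := fun k => k * (k + 2)
  let n : ℕ → ℕ := fun k => 2 ^ (2 * d k + k + 2)
  let q : ℕ → ℕ := fun k => 2 ^ (d k + k + 2)
  have hd : Primrec d := Primrec.nat_mul.comp Primrec.id
    (Primrec.nat_add.comp Primrec.id (Primrec.const 2))
  have hn : Computable n := (primrec_two_pow.comp (Primrec.nat_add.comp (Primrec.nat_add.comp
    (Primrec.nat_mul.comp (Primrec.const 2) hd) Primrec.id) (Primrec.const 2))).to_comp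
  have hq : Computable q := (primrec_two_pow.comp (Primrec.nat_add.comp (Primrec.nat_add.comp
    hd Primrec.id) (Primrec.const 2))).to_comp
  obtain ⟨m, hm, h0, hsucc, hlight⟩ := exists_computable_light_sequence ξ hξ hn hq
  obtain ⟨c, hc, hcm⟩ := exists_computableReal_of_nested hm h0 hsucc
  refine ⟨c, hc, fun x hx hx' => ?_⟩
  -- The shift drops stage 0, the whole unit interval, which was not chosen to be light.
  let p : ℕ → List Bool → Bool := fun k σ => decide (σ.count false / q (k + 1) = m (k + 1))
  have hp : Computable₂ p := (Primrec.eq (α := ℕ)).decide.to_comp.comp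
    (Primrec.nat_div.to_comp.comp (primrec_count_false.to_comp.comp Computable.snd)
      (hq.comp (Computable.succ.comp Computable.fst)))
    (hm.comp (Computable.succ.comp Computable.fst))
  have hn' : Computable fun k => n (k + 1) := hn.comp Computable.succ
  obtain ⟨i, hi⟩ := MLRandomRel.eventually_avoids hx hn' hp fun k => by
    have h := hlight k
    rw [← ENNReal.ofReal_le_ofReal_iff (by positivity), measureReal_def,
      ENNReal.ofReal_toReal (measure_ne_top _ _), one_div, ← inv_pow,
      ENNReal.ofReal_pow (by norm_num), ENNReal.ofReal_inv_of_pos two_pos,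
      ENNReal.ofReal_ofNat] at h
    simpa only [p, decide_eq_true_eq, zeroCountSet] using h
  obtain ⟨i', hi'⟩ := MLRandomRel.eventually_avoids hx' hn' (p := fun k σ => !p k σ)
    (Primrec.not.to_comp.comp hp) fun k => by
      have h := bernoulliCantor_compl_zeroCountSet_le c (k := k + 1) (hcm (k + 1)).1
        (hcm (k + 1)).2
      refine le_trans (le_of_eq ?_) h
      congr 1
      ext y
      simp [p, zeroCountSet, n, q, d]
  have h1 := hi (max i i') (le_max_left _ _)
  have h2 := hi' (max i i') (le_max_right _ _)
  simp [h1] at h2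

end CantorRandomness

theorem mainTheorem4 :
    ¬ ∃ ξ : MeasureTheory.Measure CantorRandomness.Cantor,
        MeasureTheory.IsProbabilityMeasure ξ ∧
        CantorRandomness.ComputableMeasure ξ ∧
        ∀ c : unitInterval, CantorRandomness.ComputableReal (c : ℝ) →
          ∃ x : CantorRandomness.Cantor,
            CantorRandomness.MLRandom ξ x ∧ CantorRandomness.BernoulliRandom c x := by
  rintro ⟨ξ, hξ, hcomp, h⟩
  obtain ⟨c, hc, hdisj⟩ := CantorRandomness.exists_computable_disjoint_bernoulliRandom ξ hcomp
  obtain ⟨x, hx, hx'⟩ := h c hc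
  exact hdisj x hx hx'
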